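/- Let $k$ be an algebraically closed field of characteristic zero, and let $R=k[x_0,x_1,y_0,y_1]$ be bigraded by $\deg x_i=(1,0)$ and $\deg y_i=(0,1)$. Let $X\subseteq\mathbb{P}^1\times\mathbb{P}^1$ be a finite set of points over $k$, and let $I_X\subseteq R$ be the ideal generated by the bihomogeneous forms that vanish at every point of $X$. Assume that $X$ is arithmetically Cohen-Macaulay, that is, $\operatorname{depth} R/I_X=2$, the depth being taken with respect to the ideal $(x_0,x_1,y_0,y_1)$. For $p\in X$, a separator of $p$ is a bihomogeneous form $F\in R$ with $F(p)\neq 0$ and $F(q)=0$ for all $q\in X\setminus\{p\}$. Order $\mathbb{N}^2$ componentwise. A separator $F$ of $p$ is minimal if no separator $G$ of $p$ satisfies $\deg G\prec\deg F$, and $\deg_X(p)\subseteq\mathbb{N}^2$ denotes the set of minimal elements of $\{\deg F : F \text{ is a separator of } p\}$. Let $P\times Q\in X$. Let $P\times Q,\,P_2\times Q,\dots,P_a\times Q$ be the distinct points of $X$ with second coordinate $Q$, and let $P\times Q,\,P\times Q_2,\dots,P\times Q_b$ be the distinct points of $X$ with first coordinate $P$. Then $$\deg_X(P\times Q)=\{(a-1,\,b-1)\}.$$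 Moreover, if $L_{P_i}$ is a non-zero form of degree $(1,0)$ that vanishes at $P_i$ (for $2\le i\le a$) and $L_{Q_j}$ is a non-zero form of degree $(0,1)$ that vanishes at $Q_j$ (for $2\le j\le b$), then $$L_{P_2}\cdots L_{P_a}\,L_{Q_2}\cdots L_{Q_b}$$ is a minimal separator of $P\times Q$. -/

import Mathlib

namespace BiPoints

/-- The projective line over `k`. -/
abbrev ProjLine (k : Type*) [Field k] : Type _ := Projectivization k (Fin 2 → k)

/-- The bihomogeneous coordinate ring `k[x₀, x₁, y₀, y₁]` of `ℙ¹ × ℙ¹`: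
`x_j` is `X (Sum.inl j)` and `y_j` is `X (Sum.inr j)`. -/
abbrev CoordRing (k : Type*) [Field k] : Type _ := MvPolynomial (Fin 2 ⊕ Fin 2) k

/-- The bigrading: `deg x_j = (1, 0)` and `deg y_j = (0, 1)`. -/
def bidegree : Fin 2 ⊕ Fin 2 → ℕ × ℕ :=
  Sum.elim (fun _ => (1, 0)) (fun _ => (0, 1))

variable {k : Type*} [Field k]

/-- `F` is a bihomogeneous form of bidegree `d` (the zero polynomial is one for every `d`). -/
def IsForm (F : CoordRing k) (d : ℕ × ℕ) : Prop :=
  MvPolynomial.IsWeightedHomogeneous bidegree F d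

/-- Vanishing of `F` at a point of `ℙ¹ × ℙ¹`. It is only used for bihomogeneous forms, for which
it does not depend on the representatives of the two coordinates. -/
def VanishesAt (F : CoordRing k) (p : ProjLine k × ProjLine k) : Prop :=
  MvPolynomial.eval (Sum.elim p.1.rep p.2.rep) F = 0

/-- The defining ideal `I_X`: it is generated by the bihomogeneous forms vanishing on `X`. -/
noncomputable def vanishingIdeal (X : Finset (ProjLine k × ProjLine k)) : Ideal (CoordRing k) :=
  Ideal.span {F | (∃ d, IsForm F d) ∧ ∀ p ∈ X, VanishesAt F p}

/-- The depth of a module `M` with respect to an ideal `I`: the supremum of the lengths of the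
`M`-regular sequences of elements of `I`. -/
noncomputable def depth {R : Type*} [CommRing R] (I : Ideal R)
    (M : Type*) [AddCommGroup M] [Module R M] : ℕ∞ :=
  ⨆ (rs : List R) (_ : (∀ r ∈ rs, r ∈ I) ∧ RingTheory.Sequence.IsRegular M rs),
    (rs.length : ℕ∞)

/-- The homogeneous maximal ideal `(x₀, x₁, y₀, y₁)`. -/
noncomputable def maxIdeal (k : Type*) [Field k] : Ideal (CoordRing k) :=
  Ideal.span (Set.range MvPolynomial.X)

/-- A finite set `X ⊆ ℙ¹ × ℙ¹` is arithmetically Cohen-Macaulay if `R / I_X` has depth `2`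
(which is its Krull dimension when `X` is non-empty). -/
def IsACM (X : Finset (ProjLine k × ProjLine k)) : Prop :=
  depth (maxIdeal k) (CoordRing k ⧸ vanishingIdeal X) = 2

/-- `F` is a bihomogeneous form that is non-zero at `p` and vanishes at the other points
of `X`. -/
structure IsSeparator (X : Finset (ProjLine k × ProjLine k)) (p : ProjLine k × ProjLine k)
    (F : CoordRing k) : Prop where
  isForm : ∃ d, IsForm F d
  ne_zero : ¬ VanishesAt F p
  eq_zero : ∀ q ∈ X, q ≠ p → VanishesAt F q

/-- `F` is a separator of `p`, and no separator `G` of `p` has `deg G ≺ deg F` (a separator is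
non-zero, so that its bidegree is determined). -/
def IsMinimalSeparator (X : Finset (ProjLine k × ProjLine k)) (p : ProjLine k × ProjLine k)
    (F : CoordRing k) : Prop :=
  IsSeparator X p F ∧
    ∀ G, IsSeparator X p G → ∀ d e, IsForm F d → IsForm G e → ¬ e < d

/-- The degree of the point `p` in `X`: the set of the minimal elements, for the componentwise
order of `ℕ × ℕ`, of the set of the bidegrees of the separators of `p`. -/
def pointDegree (X : Finset (ProjLine k × ProjLine k)) (p : ProjLine k × ProjLine k) :
    Set (ℕ × ℕ) :=
  {d | Minimal (fun e => ∃ F, IsSeparator X p F ∧ IsForm F e) d}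

open scoped Classical in
/-- The points of `X` whose first coordinate is `P`. -/
noncomputable def withFirst (X : Finset (ProjLine k × ProjLine k)) (P : ProjLine k) :
    Finset (ProjLine k × ProjLine k) :=
  X.filter fun p => p.1 = P

open scoped Classical in
/-- The points of `X` whose second coordinate is `Q`. -/
noncomputable def withSecond (X : Finset (ProjLine k × ProjLine k)) (Q : ProjLine k) :
    Finset (ProjLine k × ProjLine k) :=
  X.filter fun p => p.2 = Q

/-- `L` is a form of bidegree `(1, 0)` through `P` (it is unique up to a non-zero scalar). -/
def IsFirstLine (P : ProjLine k) (L : CoordRing k) : Prop :=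
  L ≠ 0 ∧ IsForm L (1, 0) ∧ ∀ Q, VanishesAt L (P, Q)

/-- `M` is a form of bidegree `(0, 1)` through `Q` (it is unique up to a non-zero scalar). -/
def IsSecondLine (Q : ProjLine k) (M : CoordRing k) : Prop :=
  M ≠ 0 ∧ IsForm M (0, 1) ∧ ∀ P, VanishesAt M (P, Q)

end BiPoints

namespace BiPoints

variable {k : Type*} [Field k]

/-! On the line with second coordinate `Q`, a separator of bidegree `(s, t)` is a binary form of
degree `s`, non-zero at `P` and zero at the other `a - 1` points of `X`. So `s ≥ a - 1`, and
likewise `t ≥ b - 1` (`IsSeparator.le_degree`).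

It remains to reach `(a - 1, b - 1)`. For any `X`, products of lines give separators of bidegrees
`(a - 1, b - 1 + j)` and `(a - 1 + i, b - 1)`. The Cohen-Macaulay hypothesis merges them: forms `L`,
`M` of bidegrees `(1, 0)`, `(0, 1)` without zeros on `X` are a regular sequence modulo `I_X`
(`IsACM.exists_sub_mem`). If `F / (L ^ (s + 1) * M ^ t)` and `G / (L ^ s * M ^ (t + 1))` are the
same function on `X`, then `L * G - M * F ∈ I_X`, so `F` is a multiple of `L` modulo `I_X` and the
function already comes from bidegree `(s, t)` (`IsACM.isFormQuotient_of_succ`).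

Counting zeros of the resulting separators shows that the rows of `X` are nested
(`IsACM.mem_or_mem`), which makes the explicit product vanish on the rest of `X`. -/

/-! ### Points of the projective line and zeros of binary forms -/

theorem exists_eq_smul_rep (B : ProjLine k) (u : Fin 2 → k)
    (h : u 0 * B.rep 1 - u 1 * B.rep 0 = 0) : ∃ c : k, u = c • B.rep := by
  by_cases h0 : B.rep 0 = 0
  · have h1 : B.rep 1 ≠ 0 := fun h1 => B.rep_nonzero (by ext i; fin_cases i <;> simpa)
    refine ⟨u 1 / B.rep 1, ?_⟩
    have hu : u 0 = 0 := by simpa [h0, h1] using h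
    ext i; fin_cases i
    · simp [h0, hu]
    · simp [h1]
  · refine ⟨u 0 / B.rep 0, ?_⟩
    ext i; fin_cases i
    · simp [h0]
    · simp only [Fin.mk_one, Pi.smul_apply, smul_eq_mul]
      field_simp
      linear_combination -h

theorem eq_of_rep_eq_smul {A B : ProjLine k} {c : k} (h : A.rep = c • B.rep) : A = B := by
  rw [← A.mk_rep, ← B.mk_rep, Projectivization.mk_eq_mk_iff']
  exact ⟨c, h.symm⟩

theorem det_rep_eq_zero_iff {A B : ProjLine k} :
    A.rep 0 * B.rep 1 - A.rep 1 * B.rep 0 = 0 ↔ A = B := by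
  constructor
  · intro h
    obtain ⟨c, hc⟩ := exists_eq_smul_rep B A.rep h
    exact eq_of_rep_eq_smul hc
  · rintro rfl; ring

theorem infinite_projLine [Infinite k] : Infinite (ProjLine k) := by
  have hne : ∀ t : k, (![1, t] : Fin 2 → k) ≠ 0 := fun t h => by
    simpa using congrFun h 0
  refine Infinite.of_injective
    (fun t : k => (Projectivization.mk k ![1, t] (hne t) : ProjLine k)) fun s t h => ?_
  obtain ⟨c, hc⟩ := (Projectivization.mk_eq_mk_iff' k _ _ (hne s) (hne t)).1 h
  have h0 : c = 1 := by simpa using congrFun hc 0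
  have h1 : c * t = s := by simpa using congrFun hc 1
  rw [← h1, h0, one_mul]

/-- A function on `k²` which is homogeneous of degree `d` and polynomial of degree at most `d` on
lines has at most `d` zeros on the projective line, unless it vanishes identically. -/
theorem card_le_of_zeros [Infinite k] {f : (Fin 2 → k) → k} {d : ℕ}
    (hpoly : ∀ v w : Fin 2 → k, ∃ g : Polynomial k, g.natDegree ≤ d ∧
      ∀ t, g.eval t = f (v + t • w))
    (hhom : ∀ (c : k) (v : Fin 2 → k), f (c • v) = c ^ d * f v)
    {Q : ProjLine k} (hQ : f Q.rep ≠ 0) (S : Finset (ProjLine k))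
    (hS : ∀ B ∈ S, f B.rep = 0) : S.card ≤ d := by
  classical
  have := infinite_projLine (k := k)
  -- The affine line `Q + t W` in `k²` meets the span of every point other than `W`, so with `W ∉ S`
  -- each zero in `S` has a parameter `τ B`, a root of `g`.
  obtain ⟨W, hW⟩ := Infinite.exists_notMem_finset (insert Q S)
  rw [Finset.mem_insert, not_or] at hW
  obtain ⟨g, hgd, hg⟩ := hpoly Q.rep W.rep
  have hg0 : g ≠ 0 := by
    rintro rfl
    exact hQ (by simpa using (hg 0).symm)
  let τ : ProjLine k → k := fun B =>
    -(Q.rep 0 * B.rep 1 - Q.rep 1 * B.rep 0) / (W.rep 0 * B.rep 1 - W.rep 1 * B.rep 0)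
  have key : ∀ B ∈ S, ∃ c : k, Q.rep + τ B • W.rep = c • B.rep := by
    intro B hB
    have hd : W.rep 0 * B.rep 1 - W.rep 1 * B.rep 0 ≠ 0 :=
      fun h => hW.2 (det_rep_eq_zero_iff.1 h ▸ hB)
    apply exists_eq_smul_rep
    have : τ B * (W.rep 0 * B.rep 1 - W.rep 1 * B.rep 0) =
      -(Q.rep 0 * B.rep 1 - Q.rep 1 * B.rep 0) := div_mul_cancel₀ _ hd
    simp only [Pi.add_apply, Pi.smul_apply, smul_eq_mul]
    linear_combination this
  calc S.card ≤ g.roots.toFinset.card := by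
        refine Finset.card_le_card_of_injOn τ ?_ ?_
        · intro B hB
          obtain ⟨c, hc⟩ := key B hB
          simp only [Finset.mem_coe, Multiset.mem_toFinset, Polynomial.mem_roots hg0,
            Polynomial.IsRoot]
          rw [hg, hc, hhom, hS B hB, mul_zero]
        · intro B hB B' hB' h
          obtain ⟨c, hc⟩ := key B hB
          obtain ⟨c', hc'⟩ := key B' hB'
          have hc0 : c ≠ 0 := by
            rintro rfl
            refine hW.1 (eq_of_rep_eq_smul (c := -τ B) ?_).symm
            rw [zero_smul] at hc
            rw [neg_smul]
            exact eq_neg_of_add_eq_zero_left hc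
          refine eq_of_rep_eq_smul (c := c⁻¹ * c') ?_
          rw [mul_smul, ← hc', ← h, hc, smul_smul, inv_mul_cancel₀ hc0, one_smul]
    _ ≤ Multiset.card g.roots := Multiset.toFinset_card_le _
    _ ≤ g.natDegree := Polynomial.card_roots' g
    _ ≤ d := hgd

/-! ### Bihomogeneous forms on the two rulings -/

theorem weight_bidegree (m : Fin 2 ⊕ Fin 2 →₀ ℕ) :
    Finsupp.weight bidegree m =
      (m (Sum.inl 0) + m (Sum.inl 1), m (Sum.inr 0) + m (Sum.inr 1)) := by
  rw [Finsupp.weight_apply, Finsupp.sum_fintype _ _ (by simp)]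
  ext <;> simp [bidegree]

theorem IsForm.eval_smul {F : CoordRing k} {d : ℕ × ℕ} (hF : IsForm F d) (s t : k)
    (x y : Fin 2 → k) :
    MvPolynomial.eval (Sum.elim (s • x) (t • y)) F =
      s ^ d.1 * t ^ d.2 * MvPolynomial.eval (Sum.elim x y) F := by
  rw [MvPolynomial.eval_eq', MvPolynomial.eval_eq', Finset.mul_sum]
  refine Finset.sum_congr rfl fun m hm => ?_
  have h := hF (MvPolynomial.mem_support_iff.1 hm)
  rw [weight_bidegree] at h
  subst h
  simp only [Fintype.prod_sum_type, Fin.prod_univ_two, Sum.elim_inl, Sum.elim_inr, Pi.smul_apply,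
    smul_eq_mul]
  ring

/-- With `π` a coordinate projection, constants may be substituted for one group of variables and
linear polynomials for the other. -/
theorem natDegree_aeval_le {F : CoordRing k} {d : ℕ × ℕ} (hF : IsForm F d) (π : ℕ × ℕ →+ ℕ)
    (g : Fin 2 ⊕ Fin 2 → Polynomial k) (hg : ∀ i, (g i).natDegree ≤ π (bidegree i)) :
    (MvPolynomial.aeval g F).natDegree ≤ π d := by
  rw [MvPolynomial.aeval_def, MvPolynomial.eval₂_eq']
  refine Polynomial.natDegree_sum_le_of_forall_le _ _ fun m hm => ?_
  refine (Polynomial.natDegree_C_mul_le _ _).trans ((Polynomial.natDegree_prod_le _ _).trans ?_)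
  rw [← hF (MvPolynomial.mem_support_iff.1 hm), Finsupp.weight_apply,
    Finsupp.sum_fintype _ _ (by simp), map_sum]
  refine Finset.sum_le_sum fun i _ => ?_
  rw [map_nsmul, smul_eq_mul]
  exact Polynomial.natDegree_pow_le.trans (Nat.mul_le_mul_left _ (hg i))

theorem eval_aeval (F : CoordRing k) (g : Fin 2 ⊕ Fin 2 → Polynomial k) (t : k) :
    (MvPolynomial.aeval g F).eval t = MvPolynomial.eval (fun i => (g i).eval t) F := by
  induction F using MvPolynomial.induction_on with
  | C a => simp
  | add p q hp hq => simp [hp, hq]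
  | mul_X p i hp => simp [hp]

theorem card_le_fst [Infinite k] {F : CoordRing k} {d : ℕ × ℕ} (hF : IsForm F d)
    {P Q : ProjLine k} (h : ¬ VanishesAt F (P, Q)) (S : Finset (ProjLine k))
    (hS : ∀ A ∈ S, VanishesAt F (A, Q)) : S.card ≤ d.1 := by
  refine card_le_of_zeros (f := fun x => MvPolynomial.eval (Sum.elim x Q.rep) F) ?_ ?_ h S hS
  · intro v w
    refine ⟨MvPolynomial.aeval (Sum.elim (fun i => Polynomial.C (v i) + Polynomial.X *
      Polynomial.C (w i)) fun i => Polynomial.C (Q.rep i)) F,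
      natDegree_aeval_le hF (AddMonoidHom.fst ℕ ℕ) _ ?_, fun t => ?_⟩
    · rintro (i | i)
      · simp only [Sum.elim_inl, bidegree, AddMonoidHom.coe_fst]
        compute_degree
      · simp [bidegree]
    · rw [eval_aeval]
      congr 2
      ext (i | i) <;> simp [mul_comm t]
  · intro c v
    simpa using hF.eval_smul c 1 v Q.rep

theorem card_le_snd [Infinite k] {F : CoordRing k} {d : ℕ × ℕ} (hF : IsForm F d)
    {P Q : ProjLine k} (h : ¬ VanishesAt F (P, Q)) (S : Finset (ProjLine k))
    (hS : ∀ B ∈ S, VanishesAt F (P, B)) : S.card ≤ d.2 := by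
  refine card_le_of_zeros (f := fun y => MvPolynomial.eval (Sum.elim P.rep y) F) ?_ ?_ h S hS
  · intro v w
    refine ⟨MvPolynomial.aeval (Sum.elim (fun i => Polynomial.C (P.rep i)) fun i =>
      Polynomial.C (v i) + Polynomial.X * Polynomial.C (w i)) F,
      natDegree_aeval_le hF (AddMonoidHom.snd ℕ ℕ) _ ?_, fun t => ?_⟩
    · rintro (i | i)
      · simp [bidegree]
      · simp only [Sum.elim_inr, bidegree, AddMonoidHom.coe_snd]
        compute_degree
    · rw [eval_aeval]
      congr 2
      ext (i | i) <;> simp [mul_comm t]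
  · intro c v
    simpa using hF.eval_smul 1 c P.rep v

theorem exists_not_vanishesAt [Infinite k] {F : CoordRing k} {d : ℕ × ℕ} (hF : IsForm F d)
    (h0 : F ≠ 0) : ∃ p, ¬ VanishesAt F p := by
  -- The extra factors force both halves of `z` to be non-zero, so that they define points of the
  -- projective line.
  have hne : F * MvPolynomial.X (Sum.inl 0) * MvPolynomial.X (Sum.inr 0) ≠ 0 :=
    mul_ne_zero (mul_ne_zero h0 (MvPolynomial.X_ne_zero _)) (MvPolynomial.X_ne_zero _)
  obtain ⟨z, hz⟩ : ∃ z, MvPolynomial.eval z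
      (F * MvPolynomial.X (Sum.inl 0) * MvPolynomial.X (Sum.inr 0)) ≠ 0 := by
    by_contra! H
    exact hne (MvPolynomial.funext fun z => by rw [H z, map_zero])
  simp only [map_mul, MvPolynomial.eval_X, mul_ne_zero_iff] at hz
  have hx : z ∘ Sum.inl ≠ 0 := fun h => hz.1.2 (congrFun h 0)
  have hy : z ∘ Sum.inr ≠ 0 := fun h => hz.2 (congrFun h 0)
  obtain ⟨s, hs⟩ := Projectivization.exists_smul_eq_mk_rep k _ hx
  obtain ⟨t, ht⟩ := Projectivization.exists_smul_eq_mk_rep k _ hy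
  refine ⟨(Projectivization.mk k _ hx, Projectivization.mk k _ hy), fun h => ?_⟩
  rw [VanishesAt, ← hs, ← ht, Units.smul_def, Units.smul_def, hF.eval_smul,
    Sum.elim_comp_inl_inr] at h
  simp [hz.1.1] at h

/-- Having degree `0` in `y`, a form with a zero over `P` vanishes on all of `{P} × ℙ¹`. Then `P`
and `A` would be two zeros of a non-zero form of degree `1` in `x`. -/
theorem IsFirstLine.not_vanishesAt [Infinite k] {A P : ProjLine k} {L : CoordRing k}
    (hL : IsFirstLine A L) (hPA : P ≠ A) (Q : ProjLine k) : ¬ VanishesAt L (P, Q) := by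
  classical
  intro h
  obtain ⟨⟨Z, W⟩, hZ⟩ := exists_not_vanishesAt hL.2.1 hL.1
  have hPW : VanishesAt L (P, W) := by
    by_contra hW
    simpa using card_le_snd hL.2.1 hW {Q} (by simpa using h)
  have := card_le_fst hL.2.1 hZ {P, A} (by simp [hPW, hL.2.2 W])
  rw [Finset.card_pair hPA] at this
  norm_num at this

theorem IsSecondLine.not_vanishesAt [Infinite k] {B Q : ProjLine k} {M : CoordRing k}
    (hM : IsSecondLine B M) (hQB : Q ≠ B) (P : ProjLine k) : ¬ VanishesAt M (P, Q) := by
  classical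
  intro h
  obtain ⟨⟨Z, W⟩, hZ⟩ := exists_not_vanishesAt hM.2.1 hM.1
  have hZQ : VanishesAt M (Z, Q) := by
    by_contra hW
    simpa using card_le_fst hM.2.1 hW {P} (by simpa using h)
  have := card_le_snd hM.2.1 hZ {Q, B} (by simp [hZQ, hM.2.2 Z])
  rw [Finset.card_pair hQB] at this
  norm_num at this

/-! ### Linear forms through a point -/

/-- The linear form in the variables `e 0`, `e 1` vanishing at `A`. -/
noncomputable def lineForm (e : Fin 2 → Fin 2 ⊕ Fin 2) (A : ProjLine k) : CoordRing k :=
  MvPolynomial.C (A.rep 1) * MvPolynomial.X (e 0) - MvPolynomial.C (A.rep 0) * MvPolynomial.X (e 1)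

theorem eval_lineForm (e : Fin 2 → Fin 2 ⊕ Fin 2) (A : ProjLine k) (z : Fin 2 ⊕ Fin 2 → k) :
    MvPolynomial.eval z (lineForm e A) = A.rep 1 * z (e 0) - A.rep 0 * z (e 1) := by
  simp [lineForm]

theorem isForm_lineForm {e : Fin 2 → Fin 2 ⊕ Fin 2} {d : ℕ × ℕ} (he : ∀ i, bidegree (e i) = d)
    (A : ProjLine k) : IsForm (lineForm e A) d := by
  have hX : ∀ (c : k) i, IsForm (MvPolynomial.C c * MvPolynomial.X (e i)) d := fun c i => by
    simpa [IsForm, he] using (MvPolynomial.isWeightedHomogeneous_C bidegree c).mul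
      (MvPolynomial.isWeightedHomogeneous_X k bidegree (e i))
  exact (MvPolynomial.weightedHomogeneousSubmodule k bidegree d).sub_mem (hX _ 0) (hX _ 1)

theorem isForm_lineForm_inl (A : ProjLine k) : IsForm (lineForm Sum.inl A) (1, 0) :=
  isForm_lineForm (e := Sum.inl) (d := (1, 0)) (fun _ => rfl) A

theorem isForm_lineForm_inr (B : ProjLine k) : IsForm (lineForm Sum.inr B) (0, 1) :=
  isForm_lineForm (e := Sum.inr) (d := (0, 1)) (fun _ => rfl) B

theorem exists_ne_projLine [Infinite k] (A : ProjLine k) : ∃ P, P ≠ A := by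
  have := infinite_projLine (k := k)
  exact exists_ne A

theorem isFirstLine_lineForm [Infinite k] (A : ProjLine k) :
    IsFirstLine A (lineForm Sum.inl A) := by
  refine ⟨fun h => ?_, isForm_lineForm_inl A, fun Q => ?_⟩
  · obtain ⟨P, hP⟩ := exists_ne_projLine A
    have := eval_lineForm Sum.inl A (Sum.elim P.rep P.rep)
    rw [h, map_zero, Sum.elim_inl, Sum.elim_inl] at this
    exact hP (det_rep_eq_zero_iff.1 (by linear_combination -this))
  · rw [VanishesAt, eval_lineForm]
    simp [mul_comm]

theorem isSecondLine_lineForm [Infinite k] (B : ProjLine k) :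
    IsSecondLine B (lineForm Sum.inr B) := by
  refine ⟨fun h => ?_, isForm_lineForm_inr B, fun Q => ?_⟩
  · obtain ⟨P, hP⟩ := exists_ne_projLine B
    have := eval_lineForm Sum.inr B (Sum.elim P.rep P.rep)
    rw [h, map_zero, Sum.elim_inr, Sum.elim_inr] at this
    exact hP (det_rep_eq_zero_iff.1 (by linear_combination -this))
  · rw [VanishesAt, eval_lineForm]
    simp [mul_comm]

/-- Two different linear forms generate both variables. -/
theorem X_mem_of_lineForm_mem {e : Fin 2 → Fin 2 ⊕ Fin 2} {A B : ProjLine k} (h : A ≠ B)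
    {I : Ideal (CoordRing k)} (hA : lineForm e A ∈ I) (hB : lineForm e B ∈ I) (i : Fin 2) :
    MvPolynomial.X (e i) ∈ I := by
  have hd : A.rep 0 * B.rep 1 - A.rep 1 * B.rep 0 ≠ 0 := fun H => h (det_rep_eq_zero_iff.1 H)
  have hmem : MvPolynomial.C (A.rep 0 * B.rep 1 - A.rep 1 * B.rep 0) *
      MvPolynomial.X (e i) ∈ I := by
    have : MvPolynomial.C (A.rep 0 * B.rep 1 - A.rep 1 * B.rep 0) * MvPolynomial.X (e i) =
        MvPolynomial.C (A.rep i) * lineForm e B - MvPolynomial.C (B.rep i) * lineForm e A := by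
      fin_cases i <;> simp [lineForm] <;> ring
    rw [this]
    exact I.sub_mem (I.mul_mem_left _ hB) (I.mul_mem_left _ hA)
  have := I.mul_mem_left (MvPolynomial.C (A.rep 0 * B.rep 1 - A.rep 1 * B.rep 0)⁻¹) hmem
  rwa [← mul_assoc, ← MvPolynomial.C_mul, inv_mul_cancel₀ hd, MvPolynomial.C_1, one_mul] at this

/-! ### Regular sequences and depth -/

/-- Since `g ^ n` is a nonzerodivisor modulo `f`, factors `f` can be split off `a` one at a time and
cancelled from the equation. -/
theorem mul_mem_of_regular_pow {S : Type*} [CommRing S] {f g : S} (hf : IsSMulRegular S f)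
    (hg : ∀ a, f ∣ g * a → f ∣ a) (m n : ℕ) {a b : S} (h : g ^ n * a = f ^ m * b) : f ^ m ∣ a := by
  have hgn : ∀ n a, f ∣ g ^ n * a → f ∣ a := by
    intro n
    induction n with
    | zero => intro a h; simpa using h
    | succ n ih => intro a h; exact ih a (hg _ (by rwa [pow_succ', mul_assoc] at h))
  induction m generalizing a with
  | zero => simp
  | succ m ih =>
    obtain ⟨c, rfl⟩ := hgn n a (h ▸ (dvd_pow_self f m.succ_ne_zero).mul_right b)
    rw [pow_succ']
    refine mul_dvd_mul_left f (ih (hf ?_))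
    simp only [smul_eq_mul]
    linear_combination h

/-- If `f, g` is a regular sequence and some powers of `f` and `g` lie in `(x, y)`, where `x` is a
nonzerodivisor, then `x, y` is a weakly regular sequence. -/
theorem dvd_of_regular {S : Type*} [CommRing S] {f g x y : S} (hf : IsSMulRegular S f)
    (hg : ∀ a, f ∣ g * a → f ∣ a) (hx : IsSMulRegular S x)
    {m n : ℕ} (hfm : f ^ m ∈ Ideal.span {x, y}) (hgn : g ^ n ∈ Ideal.span {x, y})
    {u v : S} (h : x * u = y * v) : x ∣ v := by
  obtain ⟨a, b, hab⟩ := Ideal.mem_span_pair.1 hfm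
  obtain ⟨c, d, hcd⟩ := Ideal.mem_span_pair.1 hgn
  -- Formally `w = v / x = u / y` satisfies `f ^ m * w = a * v + b * u` and `g ^ n * w = c * v + d *
  -- u`; this is the denominator-free consequence.
  have key : g ^ n * (a * v + b * u) = f ^ m * (c * v + d * u) := by
    apply hx
    simp only [smul_eq_mul]
    rw [← hab, ← hcd]
    linear_combination ((c * x + d * y) * b - (a * x + b * y) * d) * h
  obtain ⟨e, he⟩ := mul_mem_of_regular_pow hf hg m n key
  refine ⟨e, (hf.pow m) ?_⟩
  simp only [smul_eq_mul]
  have : f ^ m * v = x * (a * v + b * u) := by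
    rw [← hab]
    linear_combination -b * h
  rw [this, he]
  ring

open scoped Pointwise in
theorem exists_regular_pair_of_depth {R : Type*} [CommRing R] {I J : Ideal R}
    (h : depth I (R ⧸ J) = 2) :
    ∃ f ∈ I, ∃ g ∈ I, IsSMulRegular (R ⧸ J) (Ideal.Quotient.mk J f) ∧
      ∀ a : R ⧸ J, Ideal.Quotient.mk J f ∣ Ideal.Quotient.mk J g * a →
        Ideal.Quotient.mk J f ∣ a := by
  have h1 : (1 : ℕ∞) < depth I (R ⧸ J) := by rw [h]; norm_num
  rw [depth, lt_iSup_iff] at h1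
  obtain ⟨rs, h1⟩ := h1
  rw [lt_iSup_iff] at h1
  obtain ⟨⟨hI, hreg⟩, h1⟩ := h1
  match rs with
  | [] => simp at h1
  | [f] => simp at h1
  | f :: g :: rs =>
    have hw := hreg.toIsWeaklyRegular
    rw [RingTheory.Sequence.isWeaklyRegular_cons_iff,
      RingTheory.Sequence.isWeaklyRegular_cons_iff] at hw
    obtain ⟨hf, hg, -⟩ := hw
    refine ⟨f, hI f (by simp), g, hI g (by simp), hf, fun a ha => ?_⟩
    have hmem : ∀ b : R ⧸ J, b ∈ (f • ⊤ : Submodule R (R ⧸ J)) ↔ Ideal.Quotient.mk J f ∣ b := by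
      intro b
      rw [Submodule.mem_smul_pointwise_iff_exists]
      exact ⟨fun ⟨c, _, hc⟩ => ⟨c, hc.symm⟩, fun ⟨c, hc⟩ => ⟨c, trivial, hc.symm⟩⟩
    have := isSMulRegular_quotient_iff_mem_of_smul_mem _ g |>.1 hg a ((hmem _).2 ha)
    exact (hmem a).1 this

/-! ### The vanishing ideal -/

theorem vanishesAt_of_mem {X : Finset (ProjLine k × ProjLine k)} {F : CoordRing k}
    (hF : F ∈ vanishingIdeal X) {p : ProjLine k × ProjLine k} (hp : p ∈ X) : VanishesAt F p := by
  have : vanishingIdeal X ≤ RingHom.ker (MvPolynomial.eval (Sum.elim p.1.rep p.2.rep)) := by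
    rw [vanishingIdeal, Ideal.span_le]
    exact fun G hG => hG.2 p hp
  exact this hF

theorem IsForm.mem_vanishingIdeal {X : Finset (ProjLine k × ProjLine k)} {F : CoordRing k}
    {d : ℕ × ℕ} (hF : IsForm F d) (h : ∀ p ∈ X, VanishesAt F p) : F ∈ vanishingIdeal X :=
  Ideal.subset_span ⟨⟨d, hF⟩, h⟩

open MvPolynomial in
theorem weightedHomogeneousComponent_form_mul {L : CoordRing k} {d : ℕ × ℕ} (hL : IsForm L d)
    (F : CoordRing k) (e : ℕ × ℕ) :
    weightedHomogeneousComponent bidegree (d + e) (L * F) =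
      L * weightedHomogeneousComponent bidegree e F := by
  let _ := weightedGradedAlgebra k bidegree
  simp only [← weightedDecomposition.decompose'_apply]
  exact DirectSum.coe_decompose_mul_add_of_left_mem (weightedHomogeneousSubmodule k bidegree)
    (b := F) (j := e) hL

open MvPolynomial in
theorem mem_vanishingIdeal_iff {X : Finset (ProjLine k × ProjLine k)} {F : CoordRing k} :
    F ∈ vanishingIdeal X ↔
      ∀ d, ∀ p ∈ X, VanishesAt (weightedHomogeneousComponent bidegree d F) p := by
  let _ := weightedGradedAlgebra k bidegree
  have hhom : (vanishingIdeal X).IsHomogeneous (weightedHomogeneousSubmodule k bidegree) :=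
    Ideal.homogeneous_span _ _ fun F hF => hF.1
  rw [mem_iff_weightedHomogeneousComponent_mem k bidegree hhom]
  exact forall_congr' fun d => ⟨fun h p hp => vanishesAt_of_mem h hp,
    IsForm.mem_vanishingIdeal (weightedHomogeneousComponent_isWeightedHomogeneous d F)⟩

theorem vanishesAt_mul {F G : CoordRing k} {p : ProjLine k × ProjLine k} :
    VanishesAt (F * G) p ↔ VanishesAt F p ∨ VanishesAt G p := by
  simp [VanishesAt]

theorem vanishesAt_prod {ι : Type*} {s : Finset ι} {F : ι → CoordRing k}
    {p : ProjLine k × ProjLine k} :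
    VanishesAt (∏ i ∈ s, F i) p ↔ ∃ i ∈ s, VanishesAt (F i) p := by
  simp [VanishesAt, map_prod, Finset.prod_eq_zero_iff]

/-- A form without zeros on `X` is a nonzerodivisor modulo the ideal of `X`. -/
theorem isSMulRegular_mk {X : Finset (ProjLine k × ProjLine k)} {L : CoordRing k} {d : ℕ × ℕ}
    (hL : IsForm L d) (h : ∀ p ∈ X, ¬ VanishesAt L p) :
    IsSMulRegular (CoordRing k ⧸ vanishingIdeal X) (Ideal.Quotient.mk (vanishingIdeal X) L) := by
  rw [isSMulRegular_iff_right_eq_zero_of_smul]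
  intro a ha
  obtain ⟨F, rfl⟩ := Ideal.Quotient.mk_surjective a
  rw [smul_eq_mul, ← map_mul, Ideal.Quotient.eq_zero_iff_mem, mem_vanishingIdeal_iff] at ha
  rw [Ideal.Quotient.eq_zero_iff_mem, mem_vanishingIdeal_iff]
  intro e p hp
  have := ha (d + e) p hp
  rw [weightedHomogeneousComponent_form_mul hL, vanishesAt_mul] at this
  exact this.resolve_left (h p hp)

theorem isForm_prod {ι : Type*} {s : Finset ι} {F : ι → CoordRing k} {d : ℕ × ℕ}
    (h : ∀ i ∈ s, IsForm (F i) d) : IsForm (∏ i ∈ s, F i) (s.card • d) := by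
  have := MvPolynomial.IsWeightedHomogeneous.prod s F (fun _ => d) h
  rwa [Finset.sum_const] at this

-- A prime over the right-hand ideal contains the product of the lines through the first coordinates
-- of `X`, hence one of these lines. It differs from the line through `A`, so the two generate `x₀`
-- and `x₁`; the same works for `y`.
open scoped Classical in
theorem maxIdeal_le_radical [Infinite k] {X : Finset (ProjLine k × ProjLine k)} {A B : ProjLine k}
    (hA : ∀ p ∈ X, p.1 ≠ A) (hB : ∀ p ∈ X, p.2 ≠ B) :
    maxIdeal k ≤
      (vanishingIdeal X ⊔ Ideal.span {lineForm Sum.inl A, lineForm Sum.inr B}).radical := by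
  rw [Ideal.radical_eq_sInf]
  refine le_sInf fun 𝔭 ⟨hle, hp⟩ => ?_
  rw [maxIdeal, Ideal.span_le]
  have hI := le_sup_left.trans hle
  have hspan := Ideal.span_le.1 (le_sup_right.trans hle)
  have hLA : lineForm Sum.inl A ∈ 𝔭 := hspan (by simp)
  have hMB : lineForm Sum.inr B ∈ 𝔭 := hspan (by simp)
  have hL : ∏ P ∈ X.image Prod.fst, lineForm Sum.inl P ∈ 𝔭 := by
    refine hI (IsForm.mem_vanishingIdeal
      (isForm_prod fun P _ => (isFirstLine_lineForm P).2.1) fun p hp => ?_)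
    exact vanishesAt_prod.2 ⟨p.1, Finset.mem_image_of_mem _ hp, (isFirstLine_lineForm p.1).2.2 p.2⟩
  have hM : ∏ P ∈ X.image Prod.snd, lineForm Sum.inr P ∈ 𝔭 := by
    refine hI (IsForm.mem_vanishingIdeal
      (isForm_prod fun P _ => (isSecondLine_lineForm P).2.1) fun p hp => ?_)
    exact vanishesAt_prod.2 ⟨p.2, Finset.mem_image_of_mem _ hp, (isSecondLine_lineForm p.2).2.2 p.1⟩
  obtain ⟨P, hPX, hP⟩ := hp.prod_mem_iff.1 hL
  obtain ⟨Q, hQX, hQ⟩ := hp.prod_mem_iff.1 hM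
  obtain ⟨p, hpX, rfl⟩ := Finset.mem_image.1 hPX
  obtain ⟨q, hqX, rfl⟩ := Finset.mem_image.1 hQX
  rintro _ ⟨i | i, rfl⟩
  · exact X_mem_of_lineForm_mem (hA p hpX) hP hLA i
  · exact X_mem_of_lineForm_mem (hB q hqX) hQ hMB i

/-- Two linear forms without zeros on an arithmetically Cohen-Macaulay set `X` form a regular
sequence modulo the ideal of `X`. -/
theorem IsACM.exists_sub_mem [Infinite k] {X : Finset (ProjLine k × ProjLine k)} (hX : IsACM X)
    {A B : ProjLine k} (hA : ∀ p ∈ X, p.1 ≠ A) (hB : ∀ p ∈ X, p.2 ≠ B) {F G : CoordRing k}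
    (h : lineForm Sum.inl A * G - lineForm Sum.inr B * F ∈ vanishingIdeal X) :
    ∃ H, F - lineForm Sum.inl A * H ∈ vanishingIdeal X := by
  obtain ⟨f, hf, g, hg, hfreg, hgreg⟩ := exists_regular_pair_of_depth hX
  -- Depth supplies only some regular pair `f, g`; `dvd_of_regular` transfers regularity to the two
  -- lines once powers of `f` and `g` lie in the ideal they generate.
  have hpow : ∀ r ∈ maxIdeal k, ∃ n, Ideal.Quotient.mk (vanishingIdeal X) r ^ n ∈
      Ideal.span {Ideal.Quotient.mk (vanishingIdeal X) (lineForm Sum.inl A),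
        Ideal.Quotient.mk (vanishingIdeal X) (lineForm Sum.inr B)} := by
    intro r hr
    obtain ⟨n, hn⟩ := maxIdeal_le_radical hA hB hr
    refine ⟨n, ?_⟩
    have := Ideal.mem_map_of_mem (Ideal.Quotient.mk (vanishingIdeal X)) hn
    rwa [Ideal.map_sup, Ideal.map_quotient_self, bot_sup_eq, Ideal.map_span, Set.image_pair,
      map_pow] at this
  obtain ⟨m, hm⟩ := hpow f hf
  obtain ⟨n, hn⟩ := hpow g hg
  have hreg := isSMulRegular_mk (isFirstLine_lineForm A).2.1
    fun p hp => (isFirstLine_lineForm A).not_vanishesAt (hA p hp) p.2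
  obtain ⟨c, hc⟩ := dvd_of_regular hfreg hgreg hreg hm hn
    (u := Ideal.Quotient.mk _ G) (v := Ideal.Quotient.mk _ F)
    (by rw [← map_mul, ← map_mul]; exact Ideal.Quotient.eq.2 h)
  obtain ⟨H, rfl⟩ := Ideal.Quotient.mk_surjective c
  exact ⟨H, Ideal.Quotient.eq.1 (by rw [hc, map_mul])⟩

/-! ### Lowering the bidegree of a function on `X` -/

theorem IsForm.mul {F G : CoordRing k} {d e c : ℕ × ℕ} (hF : IsForm F d) (hG : IsForm G e)
    (h : d + e = c) : IsForm (F * G) c :=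
  h ▸ MvPolynomial.IsWeightedHomogeneous.mul hF hG

theorem IsForm.sub {F G : CoordRing k} {d : ℕ × ℕ} (hF : IsForm F d) (hG : IsForm G d) :
    IsForm (F - G) d :=
  (MvPolynomial.weightedHomogeneousSubmodule k bidegree d).sub_mem hF hG

/-- The value of `F` at the chosen representatives of the coordinates of `p`. -/
noncomputable def valueAt (p : ProjLine k × ProjLine k) : CoordRing k →+* k :=
  MvPolynomial.eval (Sum.elim p.1.rep p.2.rep)

theorem vanishesAt_iff {F : CoordRing k} {p : ProjLine k × ProjLine k} :
    VanishesAt F p ↔ valueAt p F = 0 := Iff.rfl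

/-- The function `φ` on `X` is the quotient of a form of bidegree `(s, t)` by the product of powers
of the linear forms through `A` and `B`. -/
def IsFormQuotient (X : Finset (ProjLine k × ProjLine k)) (A B : ProjLine k)
    (φ : ProjLine k × ProjLine k → k) (s t : ℕ) : Prop :=
  ∃ F, IsForm F (s, t) ∧ ∀ p ∈ X, valueAt p F =
    φ p * valueAt p (lineForm Sum.inl A) ^ s * valueAt p (lineForm Sum.inr B) ^ t

section

variable {X : Finset (ProjLine k × ProjLine k)} {A B : ProjLine k}
  {φ : ProjLine k × ProjLine k → k}

theorem IsFormQuotient.add_left {s t : ℕ} (h : IsFormQuotient X A B φ s t) (i : ℕ) :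
    IsFormQuotient X A B φ (s + i) t := by
  induction i with
  | zero => exact h
  | succ i ih =>
    obtain ⟨F, hF, hv⟩ := ih
    refine ⟨F * lineForm Sum.inl A, hF.mul (isForm_lineForm_inl A) rfl, fun p hp => ?_⟩
    rw [map_mul, hv p hp, ← add_assoc, pow_succ]
    ring

theorem IsFormQuotient.add_right {s t : ℕ} (h : IsFormQuotient X A B φ s t) (i : ℕ) :
    IsFormQuotient X A B φ s (t + i) := by
  induction i with
  | zero => exact h
  | succ i ih =>
    obtain ⟨F, hF, hv⟩ := ih
    refine ⟨F * lineForm Sum.inr B, hF.mul (isForm_lineForm_inr B) rfl, fun p hp => ?_⟩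
    rw [map_mul, hv p hp, ← add_assoc, pow_succ]
    ring

theorem IsACM.isFormQuotient_of_succ [Infinite k] (hX : IsACM X) (hA : ∀ p ∈ X, p.1 ≠ A)
    (hB : ∀ p ∈ X, p.2 ≠ B) {s t : ℕ} (h₁ : IsFormQuotient X A B φ (s + 1) t)
    (h₂ : IsFormQuotient X A B φ s (t + 1)) : IsFormQuotient X A B φ s t := by
  obtain ⟨F, hF, hFv⟩ := h₁
  obtain ⟨G, hG, hGv⟩ := h₂
  have hmem : lineForm Sum.inl A * G - lineForm Sum.inr B * F ∈ vanishingIdeal X := by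
    refine IsForm.mem_vanishingIdeal (d := (s + 1, t + 1))
      (((isForm_lineForm_inl A).mul hG ?_).sub ((isForm_lineForm_inr B).mul hF ?_)) fun p hp => ?_
    · simp [add_comm]
    · simp [add_comm]
    · rw [vanishesAt_iff, map_sub, map_mul, map_mul, hFv p hp, hGv p hp]
      ring
  obtain ⟨H, hH⟩ := hX.exists_sub_mem hA hB hmem
  -- `H` need not be homogeneous; only its part of bidegree `(s, t)` meets `F` after multiplication
  -- by the line.
  refine ⟨MvPolynomial.weightedHomogeneousComponent bidegree (s, t) H,
    MvPolynomial.weightedHomogeneousComponent_isWeightedHomogeneous _ _, fun p hp => ?_⟩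
  have hv := mem_vanishingIdeal_iff.1 hH ((1, 0) + (s, t)) p hp
  have hF' : IsForm F ((1, 0) + (s, t)) := by simpa [add_comm] using hF
  rw [map_sub, weightedHomogeneousComponent_form_mul (isForm_lineForm_inl A),
    MvPolynomial.IsWeightedHomogeneous.weightedHomogeneousComponent_same hF', vanishesAt_iff,
    map_sub, map_mul, hFv p hp] at hv
  have hne : valueAt p (lineForm Sum.inl A) ≠ 0 :=
    (isFirstLine_lineForm A).not_vanishesAt (hA p hp) p.2
  apply mul_left_cancel₀ hne
  linear_combination -hv

theorem IsACM.isFormQuotient [Infinite k] (hX : IsACM X) (hA : ∀ p ∈ X, p.1 ≠ A)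
    (hB : ∀ p ∈ X, p.2 ≠ B) {s t i j : ℕ} (h₁ : IsFormQuotient X A B φ (s + i) t)
    (h₂ : IsFormQuotient X A B φ s (t + j)) : IsFormQuotient X A B φ s t := by
  -- The case `i = 1`: lower the second degree from `t + j` to `t`, raising the other quotient to
  -- the matching degree each time. The outer induction then lowers `s + i`.
  have one : ∀ (j s : ℕ), IsFormQuotient X A B φ (s + 1) t → IsFormQuotient X A B φ s (t + j) →
      IsFormQuotient X A B φ s t := by
    intro j
    induction j with
    | zero => exact fun _ _ h => h
    | succ j ih => exact fun s h h' => ih s h (hX.isFormQuotient_of_succ hA hB (h.add_right j) h')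
  induction i with
  | zero => exact h₁
  | succ i ih => exact ih (one j (s + i) h₁ (h₂.add_left i))

end

theorem exists_notMem_image [Infinite k] {α : Type*} (X : Finset α) (f : α → ProjLine k) :
    ∃ A, ∀ p ∈ X, f p ≠ A := by
  classical
  have := infinite_projLine (k := k)
  obtain ⟨A, hA⟩ := Infinite.exists_notMem_finset (X.image f)
  exact ⟨A, fun p hp h => hA (h ▸ Finset.mem_image_of_mem f hp)⟩

theorem IsSeparator.isFormQuotient [Infinite k] {X : Finset (ProjLine k × ProjLine k)}
    {p : ProjLine k × ProjLine k} {F : CoordRing k} (hF : IsSeparator X p F) {s t : ℕ}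
    (hd : IsForm F (s, t)) (A B : ProjLine k) :
    IsFormQuotient X A B (Set.indicator {p} 1) s t := by
  classical
  -- The scalar makes the value at `p` equal to the required denominator.
  refine ⟨MvPolynomial.C (valueAt p (lineForm Sum.inl A) ^ s * valueAt p (lineForm Sum.inr B) ^ t *
    (valueAt p F)⁻¹) * F, IsForm.mul (MvPolynomial.isWeightedHomogeneous_C bidegree _) hd
    (zero_add _), fun q hq => ?_⟩
  rw [map_mul]
  by_cases hqp : q = p
  · subst hqp
    have hne : valueAt q F ≠ 0 := hF.ne_zero
    simp only [valueAt, MvPolynomial.eval_C, Set.mem_singleton_iff, Set.indicator_of_mem,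
      Pi.one_apply] at hne ⊢
    field_simp
  · rw [vanishesAt_iff.1 (hF.eq_zero q hq hqp)]
    simp [hqp]

theorem IsFormQuotient.exists_isSeparator [Infinite k] {X : Finset (ProjLine k × ProjLine k)}
    {A B : ProjLine k} {p : ProjLine k × ProjLine k} (hp : p ∈ X) (hA : p.1 ≠ A) (hB : p.2 ≠ B)
    {s t : ℕ} (h : IsFormQuotient X A B (Set.indicator {p} 1) s t) :
    ∃ F, IsSeparator X p F ∧ IsForm F (s, t) := by
  obtain ⟨F, hF, hv⟩ := h
  refine ⟨F, ⟨⟨_, hF⟩, ?_, fun q hq hqp => ?_⟩, hF⟩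
  · rw [vanishesAt_iff, hv p hp]
    have h₁ : valueAt p (lineForm Sum.inl A) ≠ 0 :=
      (isFirstLine_lineForm A).not_vanishesAt hA p.2
    have h₂ : valueAt p (lineForm Sum.inr B) ≠ 0 :=
      (isSecondLine_lineForm B).not_vanishesAt hB p.1
    simp [h₁, h₂]
  · rw [vanishesAt_iff, hv q hq]
    simp [hqp]

/-! ### Separators and the shape of `X` -/

section

variable {X : Finset (ProjLine k × ProjLine k)} {P Q : ProjLine k}

theorem mem_withFirst {p : ProjLine k × ProjLine k} : p ∈ withFirst X P ↔ p ∈ X ∧ p.1 = P := by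
  simp [withFirst]

theorem mem_withSecond {p : ProjLine k × ProjLine k} : p ∈ withSecond X Q ↔ p ∈ X ∧ p.2 = Q := by
  simp [withSecond]

open scoped Classical in
theorem card_image_fst (T : Finset (ProjLine k × ProjLine k)) (hT : T ⊆ withSecond X Q) :
    (T.image Prod.fst).card = T.card :=
  Finset.card_image_of_injOn fun _ hp _ hq h =>
    Prod.ext h ((mem_withSecond.1 (hT hp)).2.trans (mem_withSecond.1 (hT hq)).2.symm)

open scoped Classical in
theorem card_image_snd (T : Finset (ProjLine k × ProjLine k)) (hT : T ⊆ withFirst X P) :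
    (T.image Prod.snd).card = T.card :=
  Finset.card_image_of_injOn fun _ hp _ hq h =>
    Prod.ext ((mem_withFirst.1 (hT hp)).2.trans (mem_withFirst.1 (hT hq)).2.symm) h

variable [Infinite k]

/-- The number of points of `X` with second coordinate `Q` other than `(P, Q)` bounds below the
degree in the first variables of a separator of `(P, Q)`; likewise in the second variables. -/
theorem IsSeparator.le_degree (hPQ : (P, Q) ∈ X) {F : CoordRing k} (hF : IsSeparator X (P, Q) F)
    {d : ℕ × ℕ} (hd : IsForm F d) :
    ((withSecond X Q).card - 1, (withFirst X P).card - 1) ≤ d := by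
  classical
  constructor
  · have h := card_le_fst hd hF.ne_zero (((withSecond X Q).erase (P, Q)).image Prod.fst) ?_
    · rwa [card_image_fst _ (Finset.erase_subset _ _),
        Finset.card_erase_of_mem (mem_withSecond.2 ⟨hPQ, rfl⟩)] at h
    · intro A hA
      obtain ⟨p, hp, rfl⟩ := Finset.mem_image.1 hA
      obtain ⟨hne, hp⟩ := Finset.mem_erase.1 hp
      obtain ⟨hpX, rfl⟩ := mem_withSecond.1 hp
      exact hF.eq_zero p hpX hne
  · have h := card_le_snd hd hF.ne_zero (((withFirst X P).erase (P, Q)).image Prod.snd) ?_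
    · rwa [card_image_snd _ (Finset.erase_subset _ _),
        Finset.card_erase_of_mem (mem_withFirst.2 ⟨hPQ, rfl⟩)] at h
    · intro A hA
      obtain ⟨p, hp, rfl⟩ := Finset.mem_image.1 hA
      obtain ⟨hne, hp⟩ := Finset.mem_erase.1 hp
      obtain ⟨hpX, rfl⟩ := mem_withFirst.1 hp
      exact hF.eq_zero p hpX hne

/-- A product of lines through the points with second coordinate `Q` and of lines through all the
second coordinates other than `Q` separates `(P, Q)`. -/
theorem exists_isSeparator_fst (hPQ : (P, Q) ∈ X) :
    ∃ F j, IsSeparator X (P, Q) F ∧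
      IsForm F ((withSecond X Q).card - 1, (withFirst X P).card - 1 + j) := by
  classical
  have hform : IsForm ((∏ p ∈ (withSecond X Q).erase (P, Q), lineForm Sum.inl p.1) *
      ∏ B ∈ (X.image Prod.snd).erase Q, (lineForm Sum.inr B : CoordRing k))
      ((withSecond X Q).card - 1, ((X.image Prod.snd).erase Q).card) := by
    refine (isForm_prod fun p _ => isForm_lineForm_inl p.1).mul
      (isForm_prod fun B _ => isForm_lineForm_inr B) ?_
    rw [Finset.card_erase_of_mem (mem_withSecond.2 ⟨hPQ, rfl⟩)]
    simp
  have hsep : IsSeparator X (P, Q) ((∏ p ∈ (withSecond X Q).erase (P, Q), lineForm Sum.inl p.1) *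
      ∏ B ∈ (X.image Prod.snd).erase Q, (lineForm Sum.inr B : CoordRing k)) := by
    refine ⟨⟨_, hform⟩, fun h => ?_, fun q hq hne => ?_⟩
    · rcases vanishesAt_mul.1 h with h | h
      · obtain ⟨p, hp, hv⟩ := vanishesAt_prod.1 h
        obtain ⟨hne, hp⟩ := Finset.mem_erase.1 hp
        refine (isFirstLine_lineForm p.1).not_vanishesAt (fun h => hne ?_) Q hv
        exact Prod.ext h.symm (mem_withSecond.1 hp).2
      · obtain ⟨B, hB, hv⟩ := vanishesAt_prod.1 h
        exact (isSecondLine_lineForm B).not_vanishesAt (Finset.ne_of_mem_erase hB).symm P hv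
    · rw [vanishesAt_mul, vanishesAt_prod, vanishesAt_prod]
      by_cases h : q.2 = Q
      · exact Or.inl ⟨q, Finset.mem_erase.2 ⟨hne, mem_withSecond.2 ⟨hq, h⟩⟩,
          (isFirstLine_lineForm q.1).2.2 q.2⟩
      · exact Or.inr ⟨q.2, Finset.mem_erase.2 ⟨h, Finset.mem_image_of_mem _ hq⟩,
          (isSecondLine_lineForm q.2).2.2 q.1⟩
  -- The lower bound applied to this separator itself shows that its second degree is at least `b -
  -- 1`.
  obtain ⟨j, hj⟩ := Nat.exists_eq_add_of_le (hsep.le_degree hPQ hform).2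
  exact ⟨_, j, hsep, by rw [← hj]; exact hform⟩

theorem exists_isSeparator_snd (hPQ : (P, Q) ∈ X) :
    ∃ F i, IsSeparator X (P, Q) F ∧
      IsForm F ((withSecond X Q).card - 1 + i, (withFirst X P).card - 1) := by
  classical
  have hform : IsForm ((∏ A ∈ (X.image Prod.fst).erase P, (lineForm Sum.inl A : CoordRing k)) *
      ∏ p ∈ (withFirst X P).erase (P, Q), lineForm Sum.inr p.2)
      (((X.image Prod.fst).erase P).card, (withFirst X P).card - 1) := by
    refine (isForm_prod fun A _ => isForm_lineForm_inl A).mul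
      (isForm_prod fun p _ => isForm_lineForm_inr p.2) ?_
    rw [Finset.card_erase_of_mem (mem_withFirst.2 ⟨hPQ, rfl⟩)]
    simp
  have hsep : IsSeparator X (P, Q)
      ((∏ A ∈ (X.image Prod.fst).erase P, (lineForm Sum.inl A : CoordRing k)) *
      ∏ p ∈ (withFirst X P).erase (P, Q), lineForm Sum.inr p.2) := by
    refine ⟨⟨_, hform⟩, fun h => ?_, fun q hq hne => ?_⟩
    · rcases vanishesAt_mul.1 h with h | h
      · obtain ⟨A, hA, hv⟩ := vanishesAt_prod.1 h
        exact (isFirstLine_lineForm A).not_vanishesAt (Finset.ne_of_mem_erase hA).symm Q hv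
      · obtain ⟨p, hp, hv⟩ := vanishesAt_prod.1 h
        obtain ⟨hne, hp⟩ := Finset.mem_erase.1 hp
        refine (isSecondLine_lineForm p.2).not_vanishesAt (fun h => hne ?_) P hv
        exact Prod.ext (mem_withFirst.1 hp).2 h.symm
    · rw [vanishesAt_mul, vanishesAt_prod, vanishesAt_prod]
      by_cases h : q.1 = P
      · exact Or.inr ⟨q, Finset.mem_erase.2 ⟨hne, mem_withFirst.2 ⟨hq, h⟩⟩,
          (isSecondLine_lineForm q.2).2.2 q.1⟩
      · exact Or.inl ⟨q.1, Finset.mem_erase.2 ⟨h, Finset.mem_image_of_mem _ hq⟩,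
          (isFirstLine_lineForm q.1).2.2 q.2⟩
  obtain ⟨i, hi⟩ := Nat.exists_eq_add_of_le (hsep.le_degree hPQ hform).1
  exact ⟨_, i, hsep, by rw [← hi]; exact hform⟩

theorem IsACM.exists_isSeparator (hX : IsACM X) (hPQ : (P, Q) ∈ X) :
    ∃ F, IsSeparator X (P, Q) F ∧
      IsForm F ((withSecond X Q).card - 1, (withFirst X P).card - 1) := by
  obtain ⟨A, hA⟩ := exists_notMem_image X Prod.fst
  obtain ⟨B, hB⟩ := exists_notMem_image X Prod.snd
  obtain ⟨F, j, hF, hFd⟩ := exists_isSeparator_fst hPQ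
  obtain ⟨G, i, hG, hGd⟩ := exists_isSeparator_snd hPQ
  exact (hX.isFormQuotient hA hB (hG.isFormQuotient hGd A B)
    (hF.isFormQuotient hFd A B)).exists_isSeparator hPQ (hA _ hPQ) (hB _ hPQ)

/-- If `(A, B) ∈ X` and `(A, Q) ∉ X`, then the row of `A` in `X` is shorter than that of `P`. -/
theorem IsACM.card_withFirst_lt (hX : IsACM X) {A : ProjLine k} (hPQ : (P, Q) ∈ X)
    (hAP : A ≠ P) (hAQ : (A, Q) ∉ X) :
    (withFirst X A).card < (withFirst X P).card := by
  classical
  obtain ⟨F, hF, hFd⟩ := hX.exists_isSeparator hPQ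
  have hcol : 0 < (withSecond X Q).card := Finset.card_pos.2 ⟨_, mem_withSecond.2 ⟨hPQ, rfl⟩⟩
  have hrow : 0 < (withFirst X P).card := Finset.card_pos.2 ⟨_, mem_withFirst.2 ⟨hPQ, rfl⟩⟩
  -- On `ℙ¹ × {Q}` the form has degree `a - 1` and already `a - 1` zeros in `X`; `A` would be one
  -- more.
  have hne : ¬ VanishesAt F (A, Q) := by
    intro hv
    have hmem : (P, Q) ∈ withSecond X Q := mem_withSecond.2 ⟨hPQ, rfl⟩
    have h := card_le_fst hFd hF.ne_zero
      (insert A (((withSecond X Q).erase (P, Q)).image Prod.fst)) ?_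
    · rw [Finset.card_insert_of_notMem, card_image_fst _ (Finset.erase_subset _ _),
        Finset.card_erase_of_mem hmem] at h
      · exact absurd h (by simp)
      · intro hA
        obtain ⟨p, hp, rfl⟩ := Finset.mem_image.1 hA
        obtain ⟨hpX, rfl⟩ := mem_withSecond.1 (Finset.mem_of_mem_erase hp)
        exact hAQ hpX
    · intro Z hZ
      rcases Finset.mem_insert.1 hZ with rfl | hZ
      · exact hv
      obtain ⟨p, hp, rfl⟩ := Finset.mem_image.1 hZ
      obtain ⟨hne, hp⟩ := Finset.mem_erase.1 hp
      obtain ⟨hpX, rfl⟩ := mem_withSecond.1 hp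
      exact hF.eq_zero p hpX hne
  -- On `{A} × ℙ¹` the form is now non-zero of degree `b - 1`, and vanishes at every point of `X`
  -- there.
  have h := card_le_snd hFd hne ((withFirst X A).image Prod.snd) ?_
  · rw [card_image_snd _ subset_rfl] at h
    exact Nat.lt_of_le_sub_one hrow h
  · intro Z hZ
    obtain ⟨p, hp, rfl⟩ := Finset.mem_image.1 hZ
    obtain ⟨hpX, rfl⟩ := mem_withFirst.1 hp
    exact hF.eq_zero p hpX fun h => hAP (congrArg Prod.fst h)

/-- The rows of an arithmetically Cohen-Macaulay set of points are nested. -/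
theorem IsACM.mem_or_mem (hX : IsACM X) {A B : ProjLine k} (hPQ : (P, Q) ∈ X) (hAB : (A, B) ∈ X)
    (hAP : A ≠ P) : (A, Q) ∈ X ∨ (P, B) ∈ X := by
  by_contra! h
  exact lt_asymm (hX.card_withFirst_lt hPQ hAP h.1) (hX.card_withFirst_lt hAB hAP.symm h.2)

end

end BiPoints

/-! ### The explicit separator and the main theorem -/

-- Only points sharing no coordinate with `(P, Q)` need the Cohen-Macaulay hypothesis: nestedness
-- provides a factor through one of their coordinates.
open BiPoints in
open scoped Classical in
theorem isSeparator_prod_mul_prod {k : Type*} [Field k] [Infinite k]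
    {X : Finset (ProjLine k × ProjLine k)} (hX : IsACM X)
    {P Q : ProjLine k} (hPQ : (P, Q) ∈ X) {L M : ProjLine k → CoordRing k}
    (hL : ∀ A, IsFirstLine A (L A)) (hM : ∀ B, IsSecondLine B (M B)) :
    IsSeparator X (P, Q) ((∏ p ∈ (withSecond X Q).erase (P, Q), L p.1) *
      ∏ p ∈ (withFirst X P).erase (P, Q), M p.2) ∧
    IsForm ((∏ p ∈ (withSecond X Q).erase (P, Q), L p.1) *
      ∏ p ∈ (withFirst X P).erase (P, Q), M p.2)
      ((withSecond X Q).card - 1, (withFirst X P).card - 1) := by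
  have hform : IsForm ((∏ p ∈ (withSecond X Q).erase (P, Q), L p.1) *
      ∏ p ∈ (withFirst X P).erase (P, Q), M p.2)
      ((withSecond X Q).card - 1, (withFirst X P).card - 1) := by
    refine (isForm_prod fun p _ => (hL p.1).2.1).mul (isForm_prod fun p _ => (hM p.2).2.1) ?_
    rw [Finset.card_erase_of_mem (mem_withSecond.2 ⟨hPQ, rfl⟩),
      Finset.card_erase_of_mem (mem_withFirst.2 ⟨hPQ, rfl⟩)]
    simp
  refine ⟨⟨⟨_, hform⟩, fun h => ?_, fun q hq hne => ?_⟩, hform⟩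
  · rcases vanishesAt_mul.1 h with h | h
    · obtain ⟨p, hp, hv⟩ := vanishesAt_prod.1 h
      obtain ⟨hne, hp⟩ := Finset.mem_erase.1 hp
      refine (hL p.1).not_vanishesAt (fun h => hne ?_) Q hv
      exact Prod.ext h.symm (mem_withSecond.1 hp).2
    · obtain ⟨p, hp, hv⟩ := vanishesAt_prod.1 h
      obtain ⟨hne, hp⟩ := Finset.mem_erase.1 hp
      refine (hM p.2).not_vanishesAt (fun h => hne ?_) P hv
      exact Prod.ext (mem_withFirst.1 hp).2 h.symm
  · have hfst : ∀ A, (A, Q) ∈ X → A ≠ P → ∀ B,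
        VanishesAt (∏ p ∈ (withSecond X Q).erase (P, Q), L p.1) (A, B) := fun A hA hAP B =>
      vanishesAt_prod.2 ⟨(A, Q), Finset.mem_erase.2
        ⟨fun h => hAP (congrArg Prod.fst h), mem_withSecond.2 ⟨hA, rfl⟩⟩, (hL A).2.2 B⟩
    have hsnd : ∀ B, (P, B) ∈ X → B ≠ Q → ∀ A,
        VanishesAt (∏ p ∈ (withFirst X P).erase (P, Q), M p.2) (A, B) := fun B hB hBQ A =>
      vanishesAt_prod.2 ⟨(P, B), Finset.mem_erase.2
        ⟨fun h => hBQ (congrArg Prod.snd h), mem_withFirst.2 ⟨hB, rfl⟩⟩, (hM B).2.2 A⟩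
    obtain ⟨A, B⟩ := q
    rw [vanishesAt_mul]
    by_cases hAP : A = P
    · subst hAP
      exact Or.inr (hsnd B hq (fun h => hne (h ▸ rfl)) A)
    by_cases hBQ : B = Q
    · subst hBQ
      exact Or.inl (hfst A hq hAP B)
    exact (hX.mem_or_mem hPQ hq hAP).imp (fun h => hfst A h hAP B) fun h => hsnd B h hBQ A

open scoped Classical in
theorem theorem4p4 {k : Type*} [Field k] [IsAlgClosed k] [CharZero k]
    (X : Finset (BiPoints.ProjLine k × BiPoints.ProjLine k)) (hX : BiPoints.IsACM X)
    (P Q : BiPoints.ProjLine k) (hPQ : (P, Q) ∈ X) :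
    BiPoints.pointDegree X (P, Q) =
        {((BiPoints.withSecond X Q).card - 1, (BiPoints.withFirst X P).card - 1)} ∧
      ∀ L M : BiPoints.ProjLine k → BiPoints.CoordRing k,
        (∀ A, BiPoints.IsFirstLine A (L A)) → (∀ B, BiPoints.IsSecondLine B (M B)) →
        BiPoints.IsMinimalSeparator X (P, Q)
          ((∏ p ∈ (BiPoints.withSecond X Q).erase (P, Q), L p.1) *
            ∏ p ∈ (BiPoints.withFirst X P).erase (P, Q), M p.2) := by
  have : Infinite k := IsAlgClosed.instInfinite
  constructor
  · obtain ⟨F, hF, hFd⟩ := hX.exists_isSeparator hPQ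
    ext d
    rw [Set.mem_singleton_iff]
    constructor
    · rintro ⟨⟨G, hG, hGd⟩, hmin⟩
      have hle := hG.le_degree hPQ hGd
      exact le_antisymm (hmin ⟨F, hF, hFd⟩ hle) hle
    · rintro rfl
      exact ⟨⟨F, hF, hFd⟩, fun e ⟨G, hG, hGe⟩ _ => hG.le_degree hPQ hGe⟩
  · intro L M hL hM
    obtain ⟨hsep, hform⟩ := isSeparator_prod_mul_prod hX hPQ hL hM
    refine ⟨hsep, fun G hG d e hd he hlt => ?_⟩
    have hne : (∏ p ∈ (BiPoints.withSecond X Q).erase (P, Q), L p.1) *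
        ∏ p ∈ (BiPoints.withFirst X P).erase (P, Q), M p.2 ≠ 0 := fun h =>
      hsep.ne_zero (by rw [h, BiPoints.VanishesAt, map_zero])
    -- A non-zero form has only one bidegree, so `d` is `(a - 1, b - 1)`.
    rw [MvPolynomial.IsWeightedHomogeneous.inj_right hne hd hform] at hlt
    exact (hG.le_degree hPQ he).not_gt hlt
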